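/- Let $M\in\mathbb{R}^{m\times m}$ be symmetric positive definite, $\nu<m$, let $U:\mathbb{R}^m\to\mathbb{R}$ and $g:\mathbb{R}^m\to\mathbb{R}^\nu$ be analytic, $H(q,p)=\tfrac12 p^\top M^{-1}p+U(q)$, and let $\nabla g(q)\in\mathbb{R}^{m\times\nu}$ be the transpose of the Jacobian of $g$. Let $T>0$ and let $(q(t),p(t))$ be a solution on $[0,T]$ of $$\dot q=M^{-1}p,\qquad \dot p=-\nabla U(q)-\nabla g(q)\lambda,\qquad g(q)=0,\qquad q(0)=q_0,\ p(0)=p_0,$$ for some multiplier $\lambda=\lambda(t)$, with $g(q_0)=0$ and $\nabla g(q_0)^\top M^{-1}p_0=0$, and assume that $\nabla g(q(t))^\top M^{-1}\nabla g(q(t))$ is nonsingular for all $t\in[0,T]$. Where $\nabla g(q)^\top M^{-1}\nabla g(q)$ is nonsingular, put $$\lambda(q,p)=\left[\nabla g(q)^\top M^{-1}\nabla g(q)\right]^{-1}\left[\nabla^2 g(q)(M^{-1}p,M^{-1}p)-\nabla g(q)^\top M^{-1}\nabla U(q)\right].$$ Write $t_n=nh$. For every constant $K$ there is a constant $C$ such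 that for every $R>0$ there is $h_0>0$ with the following property. Let $0<h<h_0$, let $n\ge 0$ be an integer with $t_{n+1}\le T$, and let $q_n,p_n\in\mathbb{R}^m$ satisfy - $\|q_n-q(t_n)\|\le Kh$ and $\|p_n-p(t_n)\|\le Kh$; - $\nabla g(q_n)^\top M^{-1}\nabla g(q_n)$ is nonsingular; - $g(q_n)=0$; - $\|\nabla g(q_n)^\top M^{-1}p_n\|\le Kh^2$. For $\lambda\in\mathbb{R}^\nu$ consider the initial value problem with constant multiplier $$\dot u=M^{-1}v,\quad \dot v=-\nabla U(u)-\nabla g(u)\lambda,\quad t\in[t_n,t_{n+1}],\qquad u(t_n)=q_n,\ v(t_n)=p_n. \qquad (*)$$ Then there is a vector $\lambda_n\in\mathbb{R}^\nu$ such that $(*)$ with $\lambda=\lambda_n$ has a solution on $[t_n,t_{n+1}]$, and the values $q_{n+1}=u(t_{n+1})$, $p_{n+1}=v(t_{n+1})$ of every such solution satisfy - $g(q_{n+1})=0$ and $H(q_{n+1},p_{n+1})=H(q_n,p_n)$; - $\|\lambda_n-\lambda(q(t_n),p(t_n))\|\le Ch$; - $\|q_{n+1}-q(t_{n+1})\|\le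 Ch$ and $\|p_{n+1}-p(t_{n+1})\|\le Ch$; - $\|\nabla g(q_{n+1})^\top M^{-1}p_{n+1}\|\le Ch^2$. Moreover, $\lambda_n$ is unique: every $\lambda\in\mathbb{R}^\nu$ with $\|\lambda-\lambda(q(t_n),p(t_n))\|\le R$ for which $(*)$ has a solution on $[t_n,t_{n+1}]$ with $g(u(t_{n+1}))=0$ is equal to $\lambda_n$. -/

import Mathlib

noncomputable section

namespace ConstrHam

/-- `ℝᵏ` with the Euclidean norm and inner product. -/
abbrev Vec (k : ℕ) : Type := EuclideanSpace ℝ (Fin k)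

variable {m ν : ℕ}

/-- Multiplication by `M⁻¹`, as an operator on `ℝᵐ`. -/
def massInv (M : Matrix (Fin m) (Fin m) ℝ) : Vec m →L[ℝ] Vec m :=
  Matrix.toEuclideanCLM (n := Fin m) (𝕜 := ℝ) M⁻¹

/-- The separable Hamiltonian `H(q,p) = (1/2) pᵀ M⁻¹ p + U(q)`. -/
def hamiltonian (M : Matrix (Fin m) (Fin m) ℝ) (U : Vec m → ℝ) (q p : Vec m) : ℝ :=
  (1 / 2 : ℝ) * inner ℝ p (massInv M p) + U q

/-- `∇g(q)ᵀ : ℝᵐ → ℝᵛ`, the Jacobian of `g` at `q`. -/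
def gradT (g : Vec m → Vec ν) (q : Vec m) : Vec m →L[ℝ] Vec ν :=
  fderiv ℝ g q

/-- `∇g(q) : ℝᵛ → ℝᵐ`, the transpose of the Jacobian of `g` at `q`; its `j`-th column is the
gradient of the component `g_j`. -/
def grad (g : Vec m → Vec ν) (q : Vec m) : Vec ν →L[ℝ] Vec m :=
  ContinuousLinearMap.adjoint (gradT g q)

/-- `∇g(q)ᵀ M⁻¹ ∇g(q)`, as an operator on `ℝᵛ`; it is nonsingular iff it is a unit. -/
def schur (M : Matrix (Fin m) (Fin m) ℝ) (g : Vec m → Vec ν) (q : Vec m) : Vec ν →L[ℝ] Vec ν :=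
  gradT g q ∘L massInv M ∘L grad g q

/-- `∇²g(q)(w,w) ∈ ℝᵛ`, the second derivative of `g` at `q` applied to `(w,w)`. -/
def hess (g : Vec m → Vec ν) (q w : Vec m) : Vec ν :=
  fderiv ℝ (fderiv ℝ g) q w w

/-- The multiplier as a function of the state:
`[∇g(q)ᵀM⁻¹∇g(q)]⁻¹ [∇²g(q)(M⁻¹p, M⁻¹p) - ∇g(q)ᵀM⁻¹∇U(q)]`. -/
def multiplier (M : Matrix (Fin m) (Fin m) ℝ) (U : Vec m → ℝ) (g : Vec m → Vec ν)
    (q p : Vec m) : Vec ν :=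
  Ring.inverse (schur M g q)
    (hess g q (massInv M p) - gradT g q (massInv M (gradient U q)))

/-- `(q, p)` solves on `[0,T]` the constrained Hamiltonian system `q' = M⁻¹p`,
`p' = -∇U(q) - ∇g(q)λ`, `g(q) = 0`, for some multiplier function `λ = lam`, with consistent
initial values `q(0) = q₀`, `p(0) = p₀`. -/
structure IsExactSolution (M : Matrix (Fin m) (Fin m) ℝ) (U : Vec m → ℝ) (g : Vec m → Vec ν)
    (T : ℝ) (q₀ p₀ : Vec m) (q p : ℝ → Vec m) : Prop where
  init_constraint : g q₀ = 0
  init_hidden : gradT g q₀ (massInv M p₀) = 0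
  init_q : q 0 = q₀
  init_p : p 0 = p₀
  deriv_q : ∀ t ∈ Set.Icc 0 T, HasDerivWithinAt q (massInv M (p t)) (Set.Icc 0 T) t
  deriv_p : ∃ lam : ℝ → Vec ν, ∀ t ∈ Set.Icc 0 T,
    HasDerivWithinAt p (-gradient U (q t) - grad g (q t) (lam t)) (Set.Icc 0 T) t
  constraint : ∀ t ∈ Set.Icc 0 T, g (q t) = 0

/-- `(u, v)` solves on `[a,b]` the initial value problem with a constant multiplier `lam`:
`u' = M⁻¹v`, `v' = -∇U(u) - ∇g(u) lam`, `u(a) = qa`, `v(a) = pa`. -/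
structure IsStepSolution (M : Matrix (Fin m) (Fin m) ℝ) (U : Vec m → ℝ) (g : Vec m → Vec ν)
    (a b : ℝ) (qa pa : Vec m) (lam : Vec ν) (u v : ℝ → Vec m) : Prop where
  init_u : u a = qa
  init_v : v a = pa
  deriv_u : ∀ t ∈ Set.Icc a b, HasDerivWithinAt u (massInv M (v t)) (Set.Icc a b) t
  deriv_v : ∀ t ∈ Set.Icc a b,
    HasDerivWithinAt v (-gradient U (u t) - grad g (u t) lam) (Set.Icc a b) t

end ConstrHam

end

noncomputable section

namespace ConstrHam

/-! ### Contraction and short-time estimates for differential equations. -/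

section Abstract

open Set Metric

/-! Along the flow with constant multiplier λ, the first derivative of g is free of λ, and the
second is affine in λ with linear part -S, where S = ∇gᵀM⁻¹∇g. Hence over a step of length h the
endpoint value of g depends on λ like -(h²/2) S λ, up to an error that is Lipschitz in λ with
constant O(h³) (`norm_endpoint_sub_le`). Applying (2/h²) S⁻¹, with S taken at the exact point
q(t_n), turns the endpoint equation into a fixed-point problem with contraction constant O(h).

At λ(q(t_n), p(t_n)) the second derivative of g vanishes at the exact point. With the assumed
initial values of g and its derivative, the endpoint value of g is then O(h³), so the fixed point
lies within O(h) (`exists_param`). The same Lipschitz estimate on a ball enlarged by R gives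
uniqueness (`param_unique`).

The exact and the numerical state each move by O(h) in one step, and g'' = O(h) keeps the hidden
constraint O(h²) (`norm_endpoint_le`). Energy is preserved because H + λ·g is a first integral and g
vanishes at both ends (`energy_eq`). Compactness of the exact trajectory makes the constants uniform
in n; no induction over steps is involved. -/

lemma norm_pair_le {E W : Type*} [NormedAddCommGroup E] [NormedAddCommGroup W] {x : E} {l : W} {ρ : ℝ}
    (hx : ‖x‖ ≤ ρ) (hl : ‖l‖ ≤ ρ) : ‖(x, l)‖ ≤ ρ :=
  max_le hx hl

/-- A map that is `1/2`-Lipschitz on a closed ball and moves the centre by at most half the radius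
has a fixed point in the ball. -/
lemma exists_fixedPoint_closedBall {W : Type*} [NormedAddCommGroup W] [CompleteSpace W]
    {Φ : W → W} {x₀ : W} {e : ℝ} (he : 0 ≤ e)
    (hlip : ∀ x ∈ closedBall x₀ e, ∀ y ∈ closedBall x₀ e, ‖Φ x - Φ y‖ ≤ 1 / 2 * ‖x - y‖)
    (h0 : ‖Φ x₀ - x₀‖ ≤ e / 2) : ∃ x ∈ closedBall x₀ e, Φ x = x := by
  have hmaps : MapsTo Φ (closedBall x₀ e) (closedBall x₀ e) := by
    intro x hx
    have h1 := hlip x hx x₀ (mem_closedBall_self he)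
    rw [mem_closedBall, dist_eq_norm] at hx ⊢
    have h2 := norm_add_le (Φ x - Φ x₀) (Φ x₀ - x₀)
    rw [sub_add_sub_cancel] at h2
    linarith
  have hc : ContractingWith (1 / 2) (hmaps.restrict Φ _ _) := by
    refine ⟨by norm_num, LipschitzWith.of_dist_le_mul fun x y => ?_⟩
    have := hlip x x.2 y y.2
    simpa [Subtype.dist_eq, dist_eq_norm] using this
  obtain ⟨y, hy, hfix, -⟩ := hc.exists_fixedPoint' isClosed_closedBall.isComplete hmaps
    (mem_closedBall_self he) (edist_ne_top _ _)
  exact ⟨y, hy, hfix⟩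

variable {E W : Type*} [NormedAddCommGroup E] [NormedSpace ℝ E]
  [NormedAddCommGroup W] [NormedSpace ℝ W]

/-- An integral curve cannot leave a ball on which the field is bounded before the time that the
bound allows. -/
lemma norm_sub_le_of_isIntegralCurveOn {v : E → E} {z : ℝ → E} {a b L r : ℝ}
    (hz : IsIntegralCurveOn z (fun _ => v) (Icc a b)) (hL : 0 ≤ L)
    (hv : ∀ x, ‖x - z a‖ ≤ r → ‖v x‖ < L) (hr : L * (b - a) ≤ r) :
    ∀ t ∈ Icc a b, ‖z t - z a‖ ≤ L * (t - a) := by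
  have hcont : ContinuousOn (fun t => z t - z a) (Icc a b) :=
    (fun t ht => (hz t ht).continuousWithinAt.sub continuousWithinAt_const)
  have hderiv : ∀ t ∈ Ico a b, HasDerivWithinAt (fun t => z t - z a) (v (z t)) (Ici t) t := by
    intro t ht
    have h1 := (hz t ⟨ht.1, ht.2.le⟩).sub_const (z a)
    exact h1.mono_of_mem_nhdsWithin (Icc_mem_nhdsGE_of_mem ht)
  have hB : ∀ t, HasDerivAt (fun t => L * (t - a)) L t := fun t => by
    simpa using ((hasDerivAt_id t).sub_const a).const_mul L
  intro t ht
  -- Barrier argument: the strict bound on the field is needed only where the norm meets the line `L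
  -- * (t - a)`, and such a point still lies in the ball of radius `r`.
  refine image_norm_le_of_norm_deriv_right_lt_deriv_boundary hcont hderiv (by simp) hB ?_ ht
  intro s hs hs'
  refine hv _ (hs'.le.trans (le_trans ?_ hr))
  exact mul_le_mul_of_nonneg_left (by linarith [hs.2]) hL

/-- Two integral curves with the same initial value of fields that differ by at most
`L * (‖z t - z' t‖ + ε)` along the curves. -/
lemma norm_sub_le_of_norm_deriv_sub_le {z z' w w' : ℝ → E} {a b L ε : ℝ}
    (hz : ∀ t ∈ Icc a b, HasDerivWithinAt z (w t) (Icc a b) t)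
    (hz' : ∀ t ∈ Icc a b, HasDerivWithinAt z' (w' t) (Icc a b) t)
    (ha : z a = z' a) (hL : 0 ≤ L)
    (hw : ∀ t ∈ Icc a b, ‖w t - w' t‖ ≤ L * (‖z t - z' t‖ + ε))
    (hLh : L * (b - a) ≤ 1 / 2) :
    ∀ t ∈ Icc a b, ‖z t - z' t‖ ≤ 2 * L * (b - a) * ε := by
  intro t ht
  have hab : a ≤ b := ht.1.trans ht.2
  have hd : ∀ t ∈ Icc a b, HasDerivWithinAt (fun t => z t - z' t) (w t - w' t) (Icc a b) t :=
    fun t ht => (hz t ht).sub (hz' t ht)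
  have hcont : ContinuousOn (fun t => ‖z t - z' t‖) (Icc a b) :=
    (fun t ht => (hd t ht).continuousWithinAt.norm)
  -- In place of Grönwall: the mean value inequality at the time `s` of largest distance bounds the
  -- maximum by `L * (b - a) * (max + ε)`, and `hLh` absorbs half of the maximum.
  obtain ⟨s, hs, hmax⟩ := isCompact_Icc.exists_isMaxOn ⟨t, ht⟩ hcont
  have hmax' : ∀ t ∈ Icc a b, ‖z t - z' t‖ ≤ ‖z s - z' s‖ := fun t ht => hmax ht
  refine (hmax' t ht).trans ?_
  have h1 := (convex_Icc a b).norm_image_sub_le_of_norm_hasDerivWithin_le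
    (C := L * (‖z s - z' s‖ + ε)) hd
    (fun t ht => (hw t ht).trans
      (mul_le_mul_of_nonneg_left (by linarith [hmax' t ht]) hL)) (left_mem_Icc.2 hab) hs
  simp only [ha, sub_self, sub_zero, Real.norm_eq_abs] at h1
  rw [abs_of_nonneg (by linarith [hs.1])] at h1
  have h0 : 0 ≤ L * (‖z s - z' s‖ + ε) := (norm_nonneg _).trans
    ((hw s hs))
  have h2 : L * (‖z s - z' s‖ + ε) * (s - a) ≤ L * (‖z s - z' s‖ + ε) * (b - a) :=
    mul_le_mul_of_nonneg_left (by linarith [hs.2]) h0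
  nlinarith [norm_nonneg (z s - z' s)]

/-- The first-order Taylor estimate for a function whose second derivative is bounded. -/
lemma norm_le_of_norm_second_deriv_le {D D₁ D₂ : ℝ → W} {a b e κ : ℝ} (hab : a ≤ b)
    (hD : ∀ t ∈ Icc a b, HasDerivWithinAt D (D₁ t) (Icc a b) t)
    (hD₁ : ∀ t ∈ Icc a b, HasDerivWithinAt D₁ (D₂ t) (Icc a b) t)
    (h0 : D a = 0) (he : ‖D₁ a‖ ≤ e) (hκ : ∀ t ∈ Icc a b, ‖D₂ t‖ ≤ κ) :
    ‖D₁ b‖ ≤ e + κ * (b - a) ∧ ‖D b‖ ≤ (b - a) * (e + κ * (b - a)) := by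
  have hκ0 : 0 ≤ κ := (norm_nonneg _).trans (hκ a (left_mem_Icc.2 hab))
  have h1 : ∀ t ∈ Icc a b, ‖D₁ t‖ ≤ e + κ * (b - a) := by
    intro t ht
    have h := (convex_Icc a b).norm_image_sub_le_of_norm_hasDerivWithin_le hD₁ hκ
      (left_mem_Icc.2 hab) ht
    rw [Real.norm_eq_abs, abs_of_nonneg (by linarith [ht.1])] at h
    have h2 : κ * (t - a) ≤ κ * (b - a) :=
      mul_le_mul_of_nonneg_left (by linarith [ht.2]) hκ0
    have h3 := norm_sub_norm_le (D₁ t) (D₁ a)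
    linarith
  refine ⟨h1 b (right_mem_Icc.2 hab), ?_⟩
  have h := (convex_Icc a b).norm_image_sub_le_of_norm_hasDerivWithin_le hD h1
    (left_mem_Icc.2 hab) (right_mem_Icc.2 hab)
  rw [Real.norm_eq_abs, abs_of_nonneg (by linarith), h0, sub_zero] at h
  linarith

/-! ### Solving the endpoint constraint for the parameter. -/

/-- A field `f` on `E` with a parameter in `W`, and a constraint `G` of index two: along the
flow `G` has the derivative `G₁`, which does not contain the parameter, and `G₁` has the derivative
`Ψ`, which is affine in the parameter with linear part `-S`. -/
structure IsIndexTwoConstraint (f : E × W → E) (Ψ : E × W → W) (S : E → W →L[ℝ] W)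
    (G G₁ : E → W) : Prop where
  affine : ∀ x l l', Ψ (x, l) - Ψ (x, l') = -S x (l - l')
  deriv_constraint : ∀ (z : ℝ → E) (s : Set ℝ) (t : ℝ) (l : W),
    HasDerivWithinAt z (f (z t, l)) s t → HasDerivWithinAt (fun t => G (z t)) (G₁ (z t)) s t
  deriv_hidden : ∀ (z : ℝ → E) (s : Set ℝ) (t : ℝ) (l : W),
    HasDerivWithinAt z (f (z t, l)) s t → HasDerivWithinAt (fun t => G₁ (z t)) (Ψ (z t, l)) s t

/-- `L` bounds `f` and is a Lipschitz constant of `f`, `Ψ`, `S` on the ball of radius `ρ`. -/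
structure FieldBounds (f : E × W → E) (Ψ : E × W → W) (S : E → W →L[ℝ] W) (ρ L : ℝ) : Prop where
  pos : 0 < L
  norm_lt : ∀ x, ‖x‖ ≤ ρ → ‖f x‖ < L
  lip_field : ∀ x y, ‖x‖ ≤ ρ → ‖y‖ ≤ ρ → ‖f x - f y‖ ≤ L * ‖x - y‖
  lip_second : ∀ x y, ‖x‖ ≤ ρ → ‖y‖ ≤ ρ → ‖Ψ x - Ψ y‖ ≤ L * ‖x - y‖
  lip_schur : ∀ x y, ‖x‖ ≤ ρ → ‖y‖ ≤ ρ → ‖S x - S y‖ ≤ L * ‖x - y‖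

variable {f : E × W → E} {Ψ : E × W → W} {S : E → W →L[ℝ] W} {G G₁ : E → W} {ρ L : ℝ}

/-- A trajectory that starts in the ball of radius `ρ - 1` stays in the ball of radius `ρ` for a
short time. -/
lemma FieldBounds.norm_sub_le (hB : FieldBounds f Ψ S ρ L) {z : ℝ → E} {l : W} {a b : ℝ}
    (hz : IsIntegralCurveOn z (fun _ x => f (x, l)) (Icc a b)) (hza : ‖z a‖ ≤ ρ - 1)
    (hl : ‖l‖ ≤ ρ) (hLh : L * (b - a) ≤ 1 / 2) :
    ∀ t ∈ Icc a b, ‖z t - z a‖ ≤ L * (b - a) ∧ ‖z t‖ ≤ ρ := by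
  have hin : ∀ x : E, ‖x - z a‖ ≤ 1 → ‖x‖ ≤ ρ := fun x hx => by
    have := norm_le_norm_add_norm_sub' x (z a)
    linarith
  intro t ht
  have h1 := norm_sub_le_of_isIntegralCurveOn (r := 1) hz hB.pos.le
    (fun x hx => hB.norm_lt _ (norm_pair_le (hin x hx) hl)) (by linarith) t ht
  have h2 : L * (t - a) ≤ L * (b - a) :=
    mul_le_mul_of_nonneg_left (by linarith [ht.2]) hB.pos.le
  exact ⟨h1.trans h2, hin _ (by linarith)⟩

/-- Besides Lipschitz dependence on the parameter, the case `l = l'` gives uniqueness for the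
initial value problem. -/
lemma FieldBounds.norm_sub_le_of_param (hB : FieldBounds f Ψ S ρ L) {z z' : ℝ → E} {l l' : W}
    {a b : ℝ} (hz : IsIntegralCurveOn z (fun _ x => f (x, l)) (Icc a b))
    (hz' : IsIntegralCurveOn z' (fun _ x => f (x, l')) (Icc a b)) (hzz' : z a = z' a)
    (hza : ‖z a‖ ≤ ρ - 1) (hl : ‖l‖ ≤ ρ) (hl' : ‖l'‖ ≤ ρ) (hLh : L * (b - a) ≤ 1 / 2) :
    ∀ t ∈ Icc a b, ‖z t - z' t‖ ≤ 2 * L * (b - a) * ‖l - l'‖ := by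
  refine norm_sub_le_of_norm_deriv_sub_le hz hz' hzz' hB.pos.le (fun t ht => ?_) hLh
  refine (hB.lip_field _ _ (norm_pair_le (hB.norm_sub_le hz hza hl hLh t ht).2 hl)
    (norm_pair_le (hB.norm_sub_le hz' (hzz' ▸ hza) hl' hLh t ht).2 hl')).trans ?_
  refine mul_le_mul_of_nonneg_left ?_ hB.pos.le
  exact max_le (by simp) (by simp)

/-- Solutions of the initial value problem exist on short intervals. -/
lemma FieldBounds.exists_isIntegralCurveOn [CompleteSpace E] (hB : FieldBounds f Ψ S ρ L)
    {x₁ : E} {l : W} {a b : ℝ} (hab : a ≤ b) (hx₁ : ‖x₁‖ ≤ ρ - 1) (hl : ‖l‖ ≤ ρ)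
    (hLh : L * (b - a) ≤ 1 / 2) :
    ∃ z : ℝ → E, z a = x₁ ∧ IsIntegralCurveOn z (fun _ x => f (x, l)) (Icc a b) := by
  have hin : ∀ x ∈ closedBall x₁ ((1 : NNReal) : ℝ), ‖(x, l)‖ ≤ ρ := fun x hx => by
    rw [mem_closedBall, dist_eq_norm, NNReal.coe_one] at hx
    have := norm_le_norm_add_norm_sub' x x₁
    exact norm_pair_le (by linarith) hl
  -- Radius 1 is the gap between `ρ - 1` and `ρ`; `L` is both the bound and the Lipschitz constant.
  have hP : IsPicardLindelof (fun _ x => f (x, l)) (⟨a, left_mem_Icc.2 hab⟩ : Icc a b) x₁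
      1 0 ⟨L, hB.pos.le⟩ ⟨L, hB.pos.le⟩ :=
    { lipschitzOnWith := fun t _ => LipschitzOnWith.of_dist_le_mul fun x hx y hy => by
        have h := hB.lip_field _ _ (hin x hx) (hin y hy)
        have h2 : ‖(x, l) - (y, l)‖ = ‖x - y‖ := by simp [Prod.norm_def]
        rw [dist_eq_norm, dist_eq_norm]
        rwa [h2] at h
      continuousOn := fun x _ => continuousOn_const
      norm_le := fun t _ x hx => (hB.norm_lt _ (hin x hx)).le
      mul_max_le := by
        change L * max (b - a) (a - a) ≤ (1 : ℝ) - 0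
        rw [max_eq_left (by linarith)]
        linarith }
  exact hP.exists_eq_forall_mem_Icc_hasDerivWithinAt₀

/-- The dependence of the endpoint constraint on the parameter is, up to terms of higher order,
`l ↦ -(h² / 2) S(x) l`. -/
lemma IsIndexTwoConstraint.norm_endpoint_sub_le (hC : IsIndexTwoConstraint f Ψ S G G₁)
    (hB : FieldBounds f Ψ S ρ L) {z z' : ℝ → E} {l l' : W} {x : E} {a b K : ℝ} (hab : a ≤ b)
    (hz : IsIntegralCurveOn z (fun _ x => f (x, l)) (Icc a b))
    (hz' : IsIntegralCurveOn z' (fun _ x => f (x, l')) (Icc a b)) (hzz' : z a = z' a)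
    (hza : ‖z a‖ ≤ ρ - 1) (hl : ‖l‖ ≤ ρ) (hl' : ‖l'‖ ≤ ρ) (hLh : L * (b - a) ≤ 1 / 2)
    (hx : ‖x‖ ≤ ρ) (hxz : ‖z a - x‖ ≤ K * (b - a)) :
    ‖G (z b) - G (z' b) + ((b - a) ^ 2 / 2) • S x (l - l')‖
      ≤ (b - a) ^ 3 * (3 * L ^ 2 + L * K) * ‖l - l'‖ := by
  have hLp := hB.pos
  -- The added quadratic term cancels the leading part of the second derivative of `G (z t) - G (z'
  -- t)`. What remains is O(h)‖l - l'‖, and two integrations from zero data give h³.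
  have hD : ∀ t ∈ Icc a b, HasDerivWithinAt
      (fun t => G (z t) - G (z' t) + ((t - a) ^ 2 / 2) • S x (l - l'))
      (G₁ (z t) - G₁ (z' t) + (t - a) • S x (l - l')) (Icc a b) t := by
    intro t ht
    have h1 : HasDerivWithinAt (fun t : ℝ => (t - a) ^ 2 / 2) (t - a) (Icc a b) t := by
      have := ((((hasDerivAt_id t).sub_const a).pow 2).div_const 2).hasDerivWithinAt (s := Icc a b)
      refine this.congr_deriv ?_
      simp
    exact ((hC.deriv_constraint z _ t l (hz t ht)).sub
      (hC.deriv_constraint z' _ t l' (hz' t ht))).add (h1.smul_const _)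
  have hD₁ : ∀ t ∈ Icc a b, HasDerivWithinAt
      (fun t => G₁ (z t) - G₁ (z' t) + (t - a) • S x (l - l'))
      (Ψ (z t, l) - Ψ (z' t, l') + S x (l - l')) (Icc a b) t := by
    intro t ht
    have h1 := ((hasDerivWithinAt_id t (Icc a b)).sub_const a).smul_const (S x (l - l'))
    rw [one_smul] at h1
    exact ((hC.deriv_hidden z _ t l (hz t ht)).sub
      (hC.deriv_hidden z' _ t l' (hz' t ht))).add h1
  have hκ : ∀ t ∈ Icc a b, ‖Ψ (z t, l) - Ψ (z' t, l') + S x (l - l')‖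
      ≤ (b - a) * (3 * L ^ 2 + L * K) * ‖l - l'‖ := by
    intro t ht
    have hzt := (hB.norm_sub_le hz hza hl hLh t ht).2
    obtain ⟨hz't1, hz't⟩ := hB.norm_sub_le hz' (hzz' ▸ hza) hl' hLh t ht
    have hd := hB.norm_sub_le_of_param hz hz' hzz' hza hl hl' hLh t ht
    -- Change the state first, then the parameter. The first term contributes `2 * L ^ 2` to the
    -- constant, the second `L * (L + K)`.
    have e1 : Ψ (z t, l) - Ψ (z' t, l') + S x (l - l')
        = (Ψ (z t, l) - Ψ (z' t, l)) + (S x - S (z' t)) (l - l') := by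
      have h := hC.affine (z' t) l l'
      rw [sub_apply, sub_eq_add_neg (S x _), ← h]
      abel
    have h1 := hB.lip_second _ _ (norm_pair_le hzt hl) (norm_pair_le hz't hl)
    have h2 : ‖(z t, l) - (z' t, l)‖ = ‖z t - z' t‖ := by simp [Prod.norm_def]
    rw [h2] at h1
    have h3 : ‖(S x - S (z' t)) (l - l')‖ ≤ L * ((L + K) * (b - a)) * ‖l - l'‖ := by
      refine (ContinuousLinearMap.le_opNorm _ _).trans
        (mul_le_mul_of_nonneg_right ?_ (norm_nonneg _))
      refine (hB.lip_schur _ _ hx hz't).trans (mul_le_mul_of_nonneg_left ?_ hLp.le)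
      rw [norm_sub_rev]
      have := norm_add_le (z' t - z' a) (z a - x)
      rw [hzz', sub_add_sub_cancel, ← hzz'] at this
      rw [← hzz'] at hz't1
      linarith
    rw [e1]
    refine (norm_add_le _ _).trans ((add_le_add (h1.trans
      (mul_le_mul_of_nonneg_left hd hLp.le)) h3).trans (le_of_eq ?_))
    ring
  have := (norm_le_of_norm_second_deriv_le (e := 0) hab hD hD₁ (by simp [hzz']) (by simp [hzz'])
    hκ).2
  refine this.trans (le_of_eq ?_)
  ring

/-- Values at the end of a step with an approximately correct parameter. -/
lemma IsIndexTwoConstraint.norm_endpoint_le (hC : IsIndexTwoConstraint f Ψ S G G₁)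
    (hB : FieldBounds f Ψ S ρ L) {z : ℝ → E} {l l₀ : W} {x : E} {a b K B : ℝ} (hab : a ≤ b)
    (hz : IsIntegralCurveOn z (fun _ x => f (x, l)) (Icc a b))
    (hza : ‖z a‖ ≤ ρ - 1) (hl : ‖l‖ ≤ ρ) (hl₀ : ‖l₀‖ ≤ ρ) (hLh : L * (b - a) ≤ 1 / 2)
    (hx : ‖x‖ ≤ ρ) (hxz : ‖z a - x‖ ≤ K * (b - a)) (hK : 0 ≤ K) (hΨ : Ψ (x, l₀) = 0)
    (hll₀ : ‖l - l₀‖ ≤ B * (b - a)) (hB0 : 0 ≤ B)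
    (hG : G (z a) = 0) (hG₁ : ‖G₁ (z a)‖ ≤ K * (b - a) ^ 2) :
    ‖z b - x‖ ≤ (L + K) * (b - a) ∧
    ‖G₁ (z b)‖ ≤ (K + L * (L + K + B)) * (b - a) ^ 2 ∧
    ‖G (z b)‖ ≤ (K + L * (L + K + B)) * (b - a) ^ 3 := by
  have hLp := hB.pos
  have hh : 0 ≤ b - a := sub_nonneg.2 hab
  have hdist : ∀ t ∈ Icc a b, ‖z t - x‖ ≤ (L + K) * (b - a) := fun t ht => by
    have h1 := (hB.norm_sub_le hz hza hl hLh t ht).1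
    have := norm_add_le (z t - z a) (z a - x)
    rw [sub_add_sub_cancel] at this
    linarith
  -- `Ψ` vanishes at `(x, l₀)` and both arguments are O(h) away from that point.
  have hκ : ∀ t ∈ Icc a b, ‖Ψ (z t, l)‖ ≤ L * (L + K + B) * (b - a) := by
    intro t ht
    have h1 := hB.lip_second (z t, l) (x, l₀)
      (norm_pair_le (hB.norm_sub_le hz hza hl hLh t ht).2 hl) (norm_pair_le hx hl₀)
    rw [hΨ, sub_zero] at h1
    refine h1.trans ?_
    rw [mul_assoc]
    refine mul_le_mul_of_nonneg_left ?_ hLp.le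
    refine norm_pair_le ((hdist t ht).trans ?_) (hll₀.trans ?_)
    · nlinarith [mul_nonneg hB0 hh]
    · nlinarith [mul_nonneg (add_nonneg hLp.le hK) hh]
  obtain ⟨h1, h2⟩ := norm_le_of_norm_second_deriv_le hab
    (fun t ht => hC.deriv_constraint z _ t l (hz t ht))
    (fun t ht => hC.deriv_hidden z _ t l (hz t ht)) hG hG₁ hκ
  exact ⟨hdist b (right_mem_Icc.2 hab), h1.trans (le_of_eq (by ring)),
    h2.trans (le_of_eq (by ring))⟩

/-- At most one parameter in the ball of radius `ρ` makes the trajectory end on the constraint. -/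
lemma IsIndexTwoConstraint.param_unique (hC : IsIndexTwoConstraint f Ψ S G G₁)
    (hB : FieldBounds f Ψ S ρ L) {z z' : ℝ → E} {l l' : W} {x : E} {a b K c : ℝ} (hab : a < b)
    {A : W →L[ℝ] W} (hA : ∀ w, A (S x w) = w) (hAc : ‖A‖ ≤ c)
    (hz : IsIntegralCurveOn z (fun _ x => f (x, l)) (Icc a b))
    (hz' : IsIntegralCurveOn z' (fun _ x => f (x, l')) (Icc a b)) (hzz' : z a = z' a)
    (hza : ‖z a‖ ≤ ρ - 1) (hl : ‖l‖ ≤ ρ) (hl' : ‖l'‖ ≤ ρ) (hLh : L * (b - a) ≤ 1 / 2)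
    (hx : ‖x‖ ≤ ρ) (hxz : ‖z a - x‖ ≤ K * (b - a))
    (hsmall : 2 * c * (3 * L ^ 2 + L * K) * (b - a) < 1)
    (hG : G (z b) = 0) (hG' : G (z' b) = 0) : l = l' := by
  have hh : 0 < b - a := sub_pos.2 hab
  have h := hC.norm_endpoint_sub_le hB hab.le hz hz' hzz' hza hl hl' hLh hx hxz
  rw [hG, hG', sub_zero, zero_add, norm_smul, Real.norm_of_nonneg (by positivity)] at h
  have h1 : ‖S x (l - l')‖ ≤ 2 * (b - a) * (3 * L ^ 2 + L * K) * ‖l - l'‖ := by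
    refine le_of_mul_le_mul_left (h.trans (le_of_eq ?_)) (show 0 < (b - a) ^ 2 / 2 by positivity)
    ring
  have h2 : ‖l - l'‖ ≤ c * ‖S x (l - l')‖ := by
    conv_lhs => rw [← hA (l - l')]
    exact (A.le_opNorm _).trans (mul_le_mul_of_nonneg_right hAc (norm_nonneg _))
  have h3 := h2.trans (mul_le_mul_of_nonneg_left h1 ((norm_nonneg _).trans hAc))
  by_contra hne
  have hpos : 0 < ‖l - l'‖ := norm_pos_iff.2 (sub_ne_zero.2 hne)
  nlinarith [mul_lt_mul_of_pos_right hsmall hpos]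

/-- There is a parameter close to `l₀` for which the trajectory ends on the constraint. -/
lemma IsIndexTwoConstraint.exists_param [CompleteSpace E] [CompleteSpace W]
    (hC : IsIndexTwoConstraint f Ψ S G G₁)
    (hB : FieldBounds f Ψ S ρ L) {l₀ : W} {x x₁ : E} {a b K c : ℝ} (hab : a < b)
    {A : W →L[ℝ] W} (hA : ∀ w, A (S x w) = w) (hA' : ∀ w, A w = 0 → w = 0) (hAc : ‖A‖ ≤ c)
    (hx₁ : ‖x₁‖ ≤ ρ - 1) (hl₀ : ‖l₀‖ ≤ ρ - 1) (hLh : L * (b - a) ≤ 1 / 2)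
    (hx : ‖x‖ ≤ ρ) (hxz : ‖x₁ - x‖ ≤ K * (b - a)) (hK : 0 ≤ K) (hΨ : Ψ (x, l₀) = 0)
    (hsmall : 2 * c * (3 * L ^ 2 + L * K) * (b - a) ≤ 1 / 2)
    (hsmall' : 4 * c * (K + L * (L + K)) * (b - a) ≤ 1)
    (hG : G x₁ = 0) (hG₁ : ‖G₁ x₁‖ ≤ K * (b - a) ^ 2) :
    ∃ l : W, ‖l - l₀‖ ≤ 4 * c * (K + L * (L + K)) * (b - a) ∧
      ∃ z : ℝ → E, z a = x₁ ∧ IsIntegralCurveOn z (fun _ x => f (x, l)) (Icc a b) ∧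
        G (z b) = 0 := by
  have hLp := hB.pos
  have hh : 0 < b - a := sub_pos.2 hab
  have hc : 0 ≤ c := (norm_nonneg _).trans hAc
  -- Twice the bound on the first displacement `Φ l₀ - l₀`, as a contraction with factor 1/2
  -- requires.
  set e := 4 * c * (K + L * (L + K)) * (b - a) with he
  have he0 : 0 ≤ e := by positivity
  have hball : ∀ l ∈ closedBall l₀ e, ‖l‖ ≤ ρ := fun l hl => by
    rw [mem_closedBall, dist_eq_norm] at hl
    have := norm_le_norm_add_norm_sub' l l₀
    linarith
  -- A junk curve outside the ball makes `Z`, and with it `Φ`, total.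
  have hex : ∀ l : W, ∃ z : ℝ → E, l ∈ closedBall l₀ e →
      z a = x₁ ∧ IsIntegralCurveOn z (fun _ x => f (x, l)) (Icc a b) := fun l => by
    by_cases hl : l ∈ closedBall l₀ e
    · obtain ⟨z, hz⟩ := hB.exists_isIntegralCurveOn hab.le hx₁ (hball l hl) hLh
      exact ⟨z, fun _ => hz⟩
    · exact ⟨fun _ => x₁, fun h => absurd h hl⟩
  choose Z hZ using hex
  -- Newton's iteration with the derivative frozen at its leading part `-((b - a) ^ 2 / 2) • S x`.
  let Φ : W → W := fun l => l + (2 / (b - a) ^ 2) • A (G (Z l b))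
  have hlip : ∀ l ∈ closedBall l₀ e, ∀ l' ∈ closedBall l₀ e,
      ‖Φ l - Φ l'‖ ≤ 1 / 2 * ‖l - l'‖ := by
    intro l hl l' hl'
    obtain ⟨hza, hz⟩ := hZ l hl
    obtain ⟨hza', hz'⟩ := hZ l' hl'
    have h := hC.norm_endpoint_sub_le (K := K) hB hab.le hz hz' (hza.trans hza'.symm) (by rwa [hza])
      (hball l hl) (hball l' hl') hLh hx (by rwa [hza])
    have e1 : Φ l - Φ l' = (2 / (b - a) ^ 2) • A (G (Z l b) - G (Z l' b)
        + ((b - a) ^ 2 / 2) • S x (l - l')) := by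
      have e2 : (2 / (b - a) ^ 2) * ((b - a) ^ 2 / 2) = 1 := by field_simp
      simp only [Φ]
      rw [map_add, map_sub, map_smul, hA, smul_add, smul_smul, e2, one_smul, smul_sub]
      abel
    rw [e1, norm_smul, Real.norm_of_nonneg (by positivity)]
    calc 2 / (b - a) ^ 2 * ‖A (G (Z l b) - G (Z l' b) + ((b - a) ^ 2 / 2) • S x (l - l'))‖
        ≤ 2 / (b - a) ^ 2 * (c * ((b - a) ^ 3 * (3 * L ^ 2 + L * K) * ‖l - l'‖)) := by
          refine mul_le_mul_of_nonneg_left ((A.le_opNorm _).trans ?_) (by positivity)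
          exact mul_le_mul hAc h (norm_nonneg _) hc
      _ = 2 * c * (3 * L ^ 2 + L * K) * (b - a) * ‖l - l'‖ := by field_simp
      _ ≤ 1 / 2 * ‖l - l'‖ := mul_le_mul_of_nonneg_right hsmall (norm_nonneg _)
  have h0 : ‖Φ l₀ - l₀‖ ≤ e / 2 := by
    obtain ⟨hza, hz⟩ := hZ l₀ (mem_closedBall_self he0)
    have h := (hC.norm_endpoint_le (K := K) (B := 0) hB hab.le hz (by rwa [hza])
      (by linarith : ‖l₀‖ ≤ ρ) (by linarith : ‖l₀‖ ≤ ρ) hLh hx (by rwa [hza]) hK hΨ (by simp)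
      le_rfl (by rwa [hza]) (by rwa [hza])).2.2
    have e1 : Φ l₀ - l₀ = (2 / (b - a) ^ 2) • A (G (Z l₀ b)) := by simp [Φ]
    rw [e1, norm_smul, Real.norm_of_nonneg (by positivity)]
    calc 2 / (b - a) ^ 2 * ‖A (G (Z l₀ b))‖
        ≤ 2 / (b - a) ^ 2 * (c * ((K + L * (L + K + 0)) * (b - a) ^ 3)) := by
          refine mul_le_mul_of_nonneg_left ((A.le_opNorm _).trans ?_) (by positivity)
          exact mul_le_mul hAc h (norm_nonneg _) hc
      _ = e / 2 := by rw [he]; field_simp; ring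
  obtain ⟨l, hl, hfix⟩ := exists_fixedPoint_closedBall he0 hlip h0
  refine ⟨l, by rwa [mem_closedBall, dist_eq_norm] at hl, Z l, (hZ l hl).1, (hZ l hl).2, ?_⟩
  have h1 : (2 / (b - a) ^ 2) • A (G (Z l b)) = 0 := by simpa [Φ] using hfix
  exact hA' _ ((smul_eq_zero.1 h1).resolve_left (by positivity))

end Abstract

end ConstrHam

end

noncomputable section

namespace ConstrHam

/-! ### The constrained Hamiltonian system as an instance. -/

section Concrete

open Set Metric
open scoped ContDiff

variable {m ν : ℕ} (M : Matrix (Fin m) (Fin m) ℝ) (U : Vec m → ℝ) (g : Vec m → Vec ν)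

/-- The vector field of the equations of motion, as a function of `((q, p), λ)`. -/
def motionField (y : (Vec m × Vec m) × Vec ν) : Vec m × Vec m :=
  (massInv M y.1.2, -gradient U y.1.1 - grad g y.1.1 y.2)

/-- The second derivative of `g(q)` along the motion, as a function of `((q, p), λ)`. -/
def constraintAccel (y : (Vec m × Vec m) × Vec ν) : Vec ν :=
  hess g y.1.1 (massInv M y.1.2) +
    gradT g y.1.1 (massInv M (-gradient U y.1.1 - grad g y.1.1 y.2))

variable {M U g}

lemma constraintAccel_eq (z : Vec m × Vec m) (l : Vec ν) :
    constraintAccel M U g (z, l) = (hess g z.1 (massInv M z.2)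
      - gradT g z.1 (massInv M (gradient U z.1))) - schur M g z.1 l := by
  simp only [constraintAccel, schur, map_sub, map_neg, ContinuousLinearMap.comp_apply]
  abel

/-- The chain rule twice: the multiplier acts on `p` only, so it is first seen in the second
derivative of g. -/
lemma isIndexTwoConstraint (hg : ContDiff ℝ ω g) :
    IsIndexTwoConstraint (motionField M U g) (constraintAccel M U g)
      (fun z => schur M g z.1) (fun z => g z.1) (fun z => gradT g z.1 (massInv M z.2)) where
  affine z l l' := by
    rw [constraintAccel_eq, constraintAccel_eq, map_sub]
    abel
  deriv_constraint z s t l hz := by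
    exact ((hg.differentiable (by simp)) (z t).1).hasFDerivAt.comp_hasDerivWithinAt t
      hz.fst
  deriv_hidden z s t l hz := by
    have hg' : Differentiable ℝ (fderiv ℝ g) :=
      (hg.fderiv_right (m := 1) le_top).differentiable one_ne_zero
    have h1 := (hg' (z t).1).hasFDerivAt.comp_hasDerivWithinAt t hz.fst
    have h2 := (massInv M).hasFDerivAt.comp_hasDerivWithinAt t hz.snd
    exact h1.clm_apply h2

lemma contDiff_grad (hg : ContDiff ℝ ω g) : ContDiff ℝ 1 (grad g) := by
  -- The bundled adjoint is conjugate-linear; over ℝ this is linearity, restated here for the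
  -- smoothness lemma.
  have h : IsBoundedLinearMap ℝ
      (fun A : Vec m →L[ℝ] Vec ν => ContinuousLinearMap.adjoint A) :=
    { map_add := fun A B => map_add _ A B
      map_smul := fun c A => by simp
      bound := ⟨1, one_pos, fun A => by simp⟩ }
  exact h.contDiff.comp (hg.fderiv_right (m := 1) le_top)

lemma contDiff_gradient (hU : ContDiff ℝ ω U) : ContDiff ℝ 1 (gradient U) := by
  have h : IsBoundedLinearMap ℝ
      (fun A : Vec m →L[ℝ] ℝ => (InnerProductSpace.toDual ℝ (Vec m)).symm A) :=
    { map_add := fun A B => map_add _ A B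
      map_smul := fun c A => by simp
      bound := ⟨1, one_pos, fun A => by simp⟩ }
  exact h.contDiff.comp (hU.fderiv_right (m := 1) le_top)

lemma contDiff_schur (hg : ContDiff ℝ ω g) : ContDiff ℝ 1 (schur M g) :=
  (hg.fderiv_right (m := 1) le_top).clm_comp
    ((contDiff_const (c := massInv M)).clm_comp (contDiff_grad hg))

lemma contDiff_momentumField (hU : ContDiff ℝ ω U) (hg : ContDiff ℝ ω g) :
    ContDiff ℝ 1 (fun y : (Vec m × Vec m) × Vec ν => -gradient U y.1.1 - grad g y.1.1 y.2) :=
  ((contDiff_gradient hU).comp contDiff_fst.fst).neg.sub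
    (((contDiff_grad hg).comp contDiff_fst.fst).clm_apply contDiff_snd)

lemma contDiff_motionField (hU : ContDiff ℝ ω U) (hg : ContDiff ℝ ω g) :
    ContDiff ℝ 1 (motionField M U g) :=
  ((massInv M).contDiff.comp contDiff_fst.snd).prodMk (contDiff_momentumField hU hg)

lemma contDiff_constraintAccel (hU : ContDiff ℝ ω U) (hg : ContDiff ℝ ω g) :
    ContDiff ℝ 1 (constraintAccel M U g) := by
  have h1 : ContDiff ℝ 1 (fderiv ℝ g) := hg.fderiv_right le_top
  have h2 : ContDiff ℝ 1 (fderiv ℝ (fderiv ℝ g)) :=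
    (hg.fderiv_right (m := 2) le_top).fderiv_right (by norm_num)
  have h3 : ContDiff ℝ 1 (fun y : (Vec m × Vec m) × Vec ν => massInv M y.1.2) :=
    (massInv M).contDiff.comp contDiff_fst.snd
  exact (((h2.comp contDiff_fst.fst).clm_apply h3).clm_apply h3).add
    ((h1.comp contDiff_fst.fst).clm_apply
      ((massInv M).contDiff.comp (contDiff_momentumField hU hg)))

/-- A `C¹` function on a finite-dimensional space is bounded and Lipschitz on balls. -/
lemma exists_bound_lipschitz_of_contDiff {X Y : Type*} [NormedAddCommGroup X] [NormedSpace ℝ X]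
    [FiniteDimensional ℝ X] [NormedAddCommGroup Y] [NormedSpace ℝ Y] {F : X → Y}
    (hF : ContDiff ℝ 1 F) (ρ : ℝ) :
    ∃ L : ℝ, ∀ x y, ‖x‖ ≤ ρ → ‖y‖ ≤ ρ → ‖F x‖ ≤ L ∧ ‖F x - F y‖ ≤ L * ‖x - y‖ := by
  have := FiniteDimensional.proper_real X
  obtain ⟨L₁, h₁⟩ := (isCompact_closedBall (0 : X) ρ).exists_bound_of_continuousOn
    hF.continuous.continuousOn
  obtain ⟨L₂, h₂⟩ := (isCompact_closedBall (0 : X) ρ).exists_bound_of_continuousOn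
    (hF.continuous_fderiv one_ne_zero).continuousOn
  refine ⟨max L₁ L₂, fun x y hx hy => ⟨(h₁ x (by simpa using hx)).trans (le_max_left _ _), ?_⟩⟩
  refine ((convex_closedBall (0 : X) ρ).norm_image_sub_le_of_norm_fderiv_le (𝕜 := ℝ)
    (fun w _ => hF.differentiable one_ne_zero w) h₂ (by simpa using hy) (by simpa using hx)).trans ?_
  exact mul_le_mul_of_nonneg_right (le_max_right _ _) (norm_nonneg _)

lemma exists_fieldBounds (hU : ContDiff ℝ ω U) (hg : ContDiff ℝ ω g) (ρ : ℝ) :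
    ∃ L, FieldBounds (motionField M U g) (constraintAccel M U g)
      (fun z => schur M g z.1) ρ L := by
  obtain ⟨L₁, h₁⟩ := exists_bound_lipschitz_of_contDiff (contDiff_motionField (M := M) hU hg) ρ
  obtain ⟨L₂, h₂⟩ := exists_bound_lipschitz_of_contDiff (contDiff_constraintAccel (M := M) hU hg) ρ
  obtain ⟨L₃, h₃⟩ := exists_bound_lipschitz_of_contDiff
    ((contDiff_schur (M := M) hg).comp (contDiff_fst (F := Vec m))) ρ
  have a1 := le_abs_self L₁
  have a2 := le_abs_self L₂
  have a3 := le_abs_self L₃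
  have b1 := abs_nonneg L₁
  have b2 := abs_nonneg L₂
  have b3 := abs_nonneg L₃
  -- The summand 1 gives positivity and the strict bound on the field.
  refine ⟨|L₁| + |L₂| + |L₃| + 1, by positivity, fun x hx => ?_, fun x y hx hy => ?_,
    fun x y hx hy => ?_, fun x y hx hy => ?_⟩
  · linarith [(h₁ x x hx hx).1]
  · exact (h₁ x y hx hy).2.trans (mul_le_mul_of_nonneg_right (by linarith) (norm_nonneg _))
  · exact (h₂ x y hx hy).2.trans (mul_le_mul_of_nonneg_right (by linarith) (norm_nonneg _))
  · exact (h₃ x y hx hy).2.trans (mul_le_mul_of_nonneg_right (by linarith) (norm_nonneg _))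

lemma IsStepSolution.isIntegralCurveOn {a b : ℝ} {qa pa : Vec m} {l : Vec ν} {u v : ℝ → Vec m}
    (h : IsStepSolution M U g a b qa pa l u v) :
    IsIntegralCurveOn (fun t => (u t, v t)) (fun _ x => motionField M U g (x, l)) (Icc a b) :=
  fun t ht => (h.deriv_u t ht).prodMk (h.deriv_v t ht)

lemma IsStepSolution.of_isIntegralCurveOn {a b : ℝ} {qa pa : Vec m} {l : Vec ν}
    {z : ℝ → Vec m × Vec m} (ha : z a = (qa, pa))
    (hz : IsIntegralCurveOn z (fun _ x => motionField M U g (x, l)) (Icc a b)) :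
    IsStepSolution M U g a b qa pa l (fun t => (z t).1) (fun t => (z t).2) where
  init_u := by rw [ha]
  init_v := by rw [ha]
  deriv_u t ht := (hz t ht).fst
  deriv_v t ht := (hz t ht).snd

/-! ### Energy, and the multiplier of the exact solution. -/

lemma inner_massInv_comm (hM : M.PosDef) (x y : Vec m) :
    inner ℝ x (massInv M y) = inner ℝ (massInv M x) y := by
  have h : ContinuousLinearMap.adjoint (massInv M) = massInv M := by
    rw [← ContinuousLinearMap.star_eq_adjoint, massInv, ← map_star,
      Matrix.star_eq_conjTranspose, hM.isHermitian.inv.eq]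
  conv_lhs => rw [← h]
  exact ContinuousLinearMap.adjoint_inner_right _ _ _

/-- The flow with constant multiplier `l` conserves `H + l · g`. -/
lemma IsStepSolution.energy_eq (hM : M.PosDef) (hU : ContDiff ℝ ω U) (hg : ContDiff ℝ ω g)
    {a b : ℝ} {qa pa : Vec m} {l : Vec ν} {u v : ℝ → Vec m} (hab : a ≤ b)
    (h : IsStepSolution M U g a b qa pa l u v) :
    hamiltonian M U (u b) (v b) + inner ℝ (g (u b)) l
      = hamiltonian M U qa pa + inner ℝ (g qa) l := by
  have hd : ∀ t ∈ Icc a b, HasDerivWithinAt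
      (fun t => hamiltonian M U (u t) (v t) + inner ℝ (g (u t)) l) 0 (Icc a b) t := by
    intro t ht
    have hu := h.deriv_u t ht
    have hv := h.deriv_v t ht
    have h1 := hv.inner ℝ ((massInv M).hasFDerivAt.comp_hasDerivWithinAt t hv)
    have h2 := ((hU.differentiable (by simp)) (u t)).hasGradientAt.hasFDerivAt.comp_hasDerivWithinAt
      t hu
    have h3 := (((hg.differentiable (by simp)) (u t)).hasFDerivAt.comp_hasDerivWithinAt t
      hu).inner ℝ (hasDerivWithinAt_const t (Icc a b) l)
    refine (((h1.const_mul (1 / 2)).add h2).add h3).congr_deriv ?_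
    -- The power of the force `-grad g (u t) l` is minus the derivative of `inner ℝ (g (u t)) l`.
    have h4 : inner ℝ (fderiv ℝ g (u t) (massInv M (v t))) l
        = inner ℝ (massInv M (v t)) (grad g (u t) l) :=
      (ContinuousLinearMap.adjoint_inner_right _ _ _).symm
    simp only [Function.comp_apply]
    rw [h4, inner_massInv_comm hM, InnerProductSpace.toDual_apply_apply,
      real_inner_comm (massInv M (v t)) (-gradient U (u t) - grad g (u t) l), inner_sub_right,
      inner_neg_right, real_inner_comm (massInv M (v t)) (gradient U (u t)), inner_zero_right]
    ring
  have h1 := (convex_Icc a b).norm_image_sub_le_of_norm_hasDerivWithin_le (C := 0) hd (by simp)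
    (left_mem_Icc.2 hab) (right_mem_Icc.2 hab)
  rw [zero_mul, norm_le_zero_iff, sub_eq_zero, h.init_u, h.init_v] at h1
  exact h1

lemma constraintAccel_multiplier {q p : Vec m} (h : IsUnit (schur M g q)) :
    constraintAccel M U g ((q, p), multiplier M U g q p) = 0 := by
  rw [constraintAccel_eq, multiplier, ← mul_apply_eq_comp,
    Ring.mul_inverse_cancel _ h, one_apply_eq_self, sub_self]

/-- The multiplier of an exact solution is the one determined by the state. -/
lemma IsExactSolution.hasDerivWithinAt (hg : ContDiff ℝ ω g) {T : ℝ} (hT : 0 < T)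
    {q₀ p₀ : Vec m} {q p : ℝ → Vec m} (h : IsExactSolution M U g T q₀ p₀ q p)
    (hreg : ∀ t ∈ Icc 0 T, IsUnit (schur M g (q t))) {t : ℝ} (ht : t ∈ Icc 0 T) :
    HasDerivWithinAt (fun t => (q t, p t))
      (motionField M U g ((q t, p t), multiplier M U g (q t) (p t))) (Icc 0 T) t := by
  obtain ⟨lam, hlam⟩ := h.deriv_p
  have hC := isIndexTwoConstraint (M := M) (U := U) hg
  have hz : ∀ t ∈ Icc 0 T, HasDerivWithinAt (fun t => (q t, p t))
      (motionField M U g ((q t, p t), lam t)) (Icc 0 T) t :=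
    fun t ht => (h.deriv_q t ht).prodMk (hlam t ht)
  -- Derivatives within `[0,T]` are unique since `0 < T`, so the constraint may be differentiated
  -- twice, endpoints included. No regularity of `lam` is needed.
  have hzero : ∀ {F : ℝ → Vec ν} {F' : Vec ν} {t : ℝ}, t ∈ Icc 0 T → (∀ s ∈ Icc 0 T, F s = 0) →
      HasDerivWithinAt F F' (Icc 0 T) t → F' = 0 := fun {F F' t} ht hF hd =>
    (uniqueDiffOn_Icc hT t ht).eq_deriv _ hd
      ((hasDerivWithinAt_const t (Icc 0 T) (0 : Vec ν)).congr hF (hF t ht))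
  have h1 : ∀ t ∈ Icc 0 T, gradT g (q t) (massInv M (p t)) = 0 := fun t ht =>
    hzero ht h.constraint (hC.deriv_constraint (fun t => (q t, p t)) _ t _ (hz t ht))
  have h2 : constraintAccel M U g ((q t, p t), lam t) = 0 :=
    hzero ht h1 (hC.deriv_hidden (fun t => (q t, p t)) _ t _ (hz t ht))
  have h3 : lam t = multiplier M U g (q t) (p t) := by
    rw [constraintAccel_eq, sub_eq_zero] at h2
    rw [multiplier, h2, ← mul_apply_eq_comp, Ring.inverse_mul_cancel _ (hreg t ht),
      one_apply_eq_self]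
  rw [← h3]
  exact hz t ht

lemma continuousOn_inverse_schur (hg : ContDiff ℝ ω g) {s : Set ℝ} {q : ℝ → Vec m}
    (hq : ContinuousOn q s) (hreg : ∀ t ∈ s, IsUnit (schur M g (q t))) :
    ContinuousOn (fun t => Ring.inverse (schur M g (q t))) s := by
  intro t ht
  obtain ⟨w, hw⟩ := hreg t ht
  have h1 : ContinuousAt Ring.inverse (schur M g (q t)) := hw ▸ NormedRing.inverse_continuousAt w
  have h2 : ContinuousWithinAt (fun t => schur M g (q t)) s t :=
    (contDiff_schur hg).continuous.continuousAt.comp_continuousWithinAt (hq t ht)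
  exact ContinuousAt.comp_continuousWithinAt (f := fun t => schur M g (q t)) h1 h2

lemma continuousOn_multiplier (hU : ContDiff ℝ ω U) (hg : ContDiff ℝ ω g) {s : Set ℝ}
    {q p : ℝ → Vec m} (hq : ContinuousOn q s) (hp : ContinuousOn p s)
    (hreg : ∀ t ∈ s, IsUnit (schur M g (q t))) :
    ContinuousOn (fun t => multiplier M U g (q t) (p t)) s := by
  -- The bracket in `multiplier` is `constraintAccel` at parameter 0.
  have h1 : ContinuousOn (fun t => constraintAccel M U g ((q t, p t), (0 : Vec ν))) s :=
    (contDiff_constraintAccel hU hg).continuous.comp_continuousOn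
      ((hq.prodMk hp).prodMk continuousOn_const)
  refine ((continuousOn_inverse_schur hg hq hreg).clm_apply h1).congr fun t _ => ?_
  simp only [constraintAccel_eq, map_zero, sub_zero]
  rfl

end Concrete

end ConstrHam

end

/-! ### Choice of constants and proof of the theorem. -/

open scoped ContDiff in
open ConstrHam in
theorem theorem8 {m ν : ℕ} (_hνm : ν < m)
    (M : Matrix (Fin m) (Fin m) ℝ) (hM : M.PosDef)
    (U : ConstrHam.Vec m → ℝ) (hU : AnalyticOnNhd ℝ U Set.univ)
    (g : ConstrHam.Vec m → ConstrHam.Vec ν) (hg : AnalyticOnNhd ℝ g Set.univ)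
    (T : ℝ) (hT : 0 < T) (q₀ p₀ : ConstrHam.Vec m) (q p : ℝ → ConstrHam.Vec m)
    (hqp : ConstrHam.IsExactSolution M U g T q₀ p₀ q p)
    -- all points of the exact trajectory are regular for the constraints
    (hreg : ∀ t ∈ Set.Icc 0 T, IsUnit (ConstrHam.schur M g (q t))) :
    -- `K` is the constant in the hypotheses `O(h)`, `O(h^2)`; `C` is the one in the conclusions
    ∀ K : ℝ, ∃ C : ℝ, ∀ R > (0 : ℝ), ∃ h₀ > (0 : ℝ), ∀ h : ℝ, 0 < h → h < h₀ →
      ∀ n : ℕ, ((n : ℝ) + 1) * h ≤ T →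
      ∀ qn pn : ConstrHam.Vec m,
        ‖qn - q (n * h)‖ ≤ K * h → ‖pn - p (n * h)‖ ≤ K * h →
        IsUnit (ConstrHam.schur M g qn) →
        g qn = 0 →
        ‖ConstrHam.gradT g qn (ConstrHam.massInv M pn)‖ ≤ K * h ^ 2 →
        ∃ lam : ConstrHam.Vec ν,
          (∃ u v : ℝ → ConstrHam.Vec m,
            ConstrHam.IsStepSolution M U g (n * h) (((n : ℝ) + 1) * h) qn pn lam u v) ∧
          (∀ u v : ℝ → ConstrHam.Vec m,
            ConstrHam.IsStepSolution M U g (n * h) (((n : ℝ) + 1) * h) qn pn lam u v →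
            g (u (((n : ℝ) + 1) * h)) = 0 ∧
            ConstrHam.hamiltonian M U (u (((n : ℝ) + 1) * h)) (v (((n : ℝ) + 1) * h))
              = ConstrHam.hamiltonian M U qn pn ∧
            ‖u (((n : ℝ) + 1) * h) - q (((n : ℝ) + 1) * h)‖ ≤ C * h ∧
            ‖v (((n : ℝ) + 1) * h) - p (((n : ℝ) + 1) * h)‖ ≤ C * h ∧
            ‖ConstrHam.gradT g (u (((n : ℝ) + 1) * h))
              (ConstrHam.massInv M (v (((n : ℝ) + 1) * h)))‖ ≤ C * h ^ 2) ∧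
          ‖lam - ConstrHam.multiplier M U g (q (n * h)) (p (n * h))‖ ≤ C * h ∧
          (∀ (lam' : ConstrHam.Vec ν) (u' v' : ℝ → ConstrHam.Vec m),
            ‖lam' - ConstrHam.multiplier M U g (q (n * h)) (p (n * h))‖ ≤ R →
            ConstrHam.IsStepSolution M U g (n * h) (((n : ℝ) + 1) * h) qn pn lam' u' v' →
            g (u' (((n : ℝ) + 1) * h)) = 0 →
            lam' = lam) := by
  have hU' : ContDiff ℝ ω U := hU.contDiff
  have hg' : ContDiff ℝ ω g := hg.contDiff
  have hC := isIndexTwoConstraint (M := M) (U := U) hg'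
  have hzd := fun t (ht : t ∈ Set.Icc 0 T) => hqp.hasDerivWithinAt hg' hT hreg ht
  have hq : ContinuousOn q (Set.Icc 0 T) := fun t ht => (hqp.deriv_q t ht).continuousWithinAt
  have hp : ContinuousOn p (Set.Icc 0 T) := fun t ht =>
    (HasDerivWithinAt.continuousWithinAt (hzd t ht)).snd
  obtain ⟨r₁, hr₁⟩ := isCompact_Icc.exists_bound_of_continuousOn (hq.prodMk hp)
  obtain ⟨r₂, hr₂⟩ := isCompact_Icc.exists_bound_of_continuousOn
    (continuousOn_multiplier hU' hg' hq hp hreg)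
  obtain ⟨c, hc⟩ := isCompact_Icc.exists_bound_of_continuousOn
    (continuousOn_inverse_schur hg' hq hreg)
  have h0T : (0 : ℝ) ∈ Set.Icc 0 T := ⟨le_rfl, hT.le⟩
  have hc0 : 0 ≤ c := (norm_nonneg _).trans (hc 0 h0T)
  set r := max r₁ r₂ with hr
  have hzr : ∀ t ∈ Set.Icc 0 T, ‖(q t, p t)‖ ≤ r := fun t ht =>
    (hr₁ t ht).trans (le_max_left _ _)
  have hlr : ∀ t ∈ Set.Icc 0 T, ‖multiplier M U g (q t) (p t)‖ ≤ r := fun t ht =>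
    (hr₂ t ht).trans (le_max_right _ _)
  -- Exact data lie within `r` and step data within `r + 1`; the last unit is room for the
  -- trajectory.
  obtain ⟨L, hB⟩ := exists_fieldBounds (M := M) hU' hg' (r + 2)
  have hL := hB.pos
  have hdrift : ∀ s ∈ Set.Icc 0 T, ∀ t ∈ Set.Icc 0 T,
      ‖(q t, p t) - (q s, p s)‖ ≤ L * ‖t - s‖ := fun s hs t ht =>
    (convex_Icc 0 T).norm_image_sub_le_of_norm_hasDerivWithin_le hzd
      (fun t ht => (hB.norm_lt _ (norm_pair_le ((hzr t ht).trans (by linarith))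
        ((hlr t ht).trans (by linarith)))).le) hs ht
  intro K'
  set K := |K'| with hKdef
  have hK : 0 ≤ K := abs_nonneg _
  set B := 4 * c * (K + L * (L + K)) with hBdef
  have hB0 : 0 ≤ B := by positivity
  have hC2 : 0 ≤ K + L * (L + K + B) := by positivity
  -- The summands serve the multiplier, the state (`L + K` from the numerical step, `L` from the
  -- exact motion) and the hidden constraint.
  refine ⟨B + (2 * L + K) + (K + L * (L + K + B)), fun R hR => ?_⟩
  -- `L'` depends on `R`, but it is used only for uniqueness and enters only `h₀`.
  obtain ⟨L', hB'⟩ := exists_fieldBounds (M := M) hU' hg' (r + 2 + R)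
  have hL' := hB'.pos
  set κ := 2 * c * (3 * L ^ 2 + L * K) with hκ
  set κ' := 2 * c * (3 * L' ^ 2 + L' * K) with hκ'
  have hκ0 : 0 ≤ κ := by positivity
  have hκ0' : 0 ≤ κ' := by positivity
  -- Each smallness condition on h uses one summand of the denominator.
  refine ⟨1 / (1 + K + 2 * L + 2 * L' + B + 2 * κ + κ'), by positivity, ?_⟩
  intro h hh hlt n hn qn pn hqn hpn _ hgn hhid
  rw [lt_div_iff₀ (by positivity)] at hlt
  have s1 := mul_nonneg hh.le hK
  have s2 := mul_nonneg hh.le hL.le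
  have s3 := mul_nonneg hh.le hL'.le
  have s4 := mul_nonneg hh.le hB0
  have s5 := mul_nonneg hh.le hκ0
  have s6 := mul_nonneg hh.le hκ0'
  ring_nf at hlt
  set a := (n : ℝ) * h with ha
  set b := ((n : ℝ) + 1) * h with hb
  have hba : b - a = h := by rw [ha, hb]; ring
  have hab : a < b := by linarith
  have haT : a ∈ Set.Icc 0 T := ⟨by positivity, by linarith⟩
  have hbT : b ∈ Set.Icc 0 T := ⟨by positivity, hn⟩
  have hunit := hreg a haT
  have hxz : ‖(qn, pn) - (q a, p a)‖ ≤ K * (b - a) := by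
    rw [hba]
    have := mul_le_mul_of_nonneg_right (le_abs_self K') hh.le
    exact norm_pair_le (hqn.trans this) (hpn.trans this)
  have hhid' : ‖gradT g qn (massInv M pn)‖ ≤ K * (b - a) ^ 2 := by
    rw [hba]
    exact hhid.trans (mul_le_mul_of_nonneg_right (le_abs_self K') (by positivity))
  have hxn : ‖(qn, pn)‖ ≤ r + 1 := by
    have h1 := norm_le_norm_add_norm_sub' (qn, pn) (q a, p a)
    have h2 := hzr a haT
    rw [hba] at hxz
    linarith
  have hx := hzr a haT
  have hl₀ := hlr a haT
  have hA : ∀ w, Ring.inverse (schur M g (q a)) (schur M g (q a) w) = w := fun w => by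
    rw [← mul_apply_eq_comp, Ring.inverse_mul_cancel _ hunit, one_apply_eq_self]
  have hA' : ∀ w, Ring.inverse (schur M g (q a)) w = 0 → w = 0 := fun w hw => by
    rw [← one_apply_eq_self (F := Vec ν →L[ℝ] Vec ν) w, ← Ring.mul_inverse_cancel _ hunit,
      mul_apply_eq_comp, hw, map_zero]
  have hΨ := constraintAccel_multiplier (U := U) (p := p a) hunit
  obtain ⟨l, hl, z, hza, hz, hgz⟩ := hC.exists_param hB hab hA hA' (hc a haT)
    (x := (q a, p a)) (x₁ := (qn, pn)) (K := K)
    (by linarith) (by linarith : ‖multiplier M U g (q a) (p a)‖ ≤ r + 2 - 1)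
    (by rw [hba]; linarith) (by linarith) hxz hK hΨ (by rw [hba]; linarith) (by rw [hba]; linarith)
    hgn hhid'
  rw [← hBdef] at hl
  have hln : ‖l‖ ≤ r + 1 := by
    have h1 := norm_le_norm_add_norm_sub' l (multiplier M U g (q a) (p a))
    rw [hba] at hl
    linarith
  refine ⟨l, ⟨_, _, IsStepSolution.of_isIntegralCurveOn hza hz⟩, ?_, ?_, ?_⟩
  · intro u v huv
    have hw := huv.isIntegralCurveOn
    have hwa : (u a, v a) = (qn, pn) := by rw [huv.init_u, huv.init_v]
    -- Equal parameters make the Lipschitz bound zero, so every solution ends where the constructed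
    -- one does.
    have heq : (u b, v b) = z b := by
      have := hB.norm_sub_le_of_param hw hz (hwa.trans hza.symm)
        (by rw [hwa]; linarith) (by linarith) (by linarith) (by rw [hba]; linarith) b
        (Set.right_mem_Icc.2 hab.le)
      rw [sub_self, norm_zero, mul_zero, norm_le_zero_iff, sub_eq_zero] at this
      exact this
    have hgu : g (u b) = 0 := by
      rw [← hgz, ← heq]
    obtain ⟨e1, e2, -⟩ := hC.norm_endpoint_le hB hab.le hw (by rw [hwa]; linarith) (by linarith)
      (by linarith : ‖multiplier M U g (q a) (p a)‖ ≤ r + 2) (by rw [hba]; linarith)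
      (by linarith) (by rw [hwa]; exact hxz) hK hΨ hl hB0 (by rw [hwa]; exact hgn)
      (by rw [hwa]; exact hhid')
    have hdr := hdrift a haT b hbT
    rw [hba, Real.norm_of_nonneg hh.le] at hdr
    rw [hba] at e1 e2
    have e3 : ‖(u b, v b) - (q b, p b)‖
        ≤ (B + (2 * L + K) + (K + L * (L + K + B))) * h := by
      have h1 := norm_sub_le ((u b, v b) - (q a, p a)) ((q b, p b) - (q a, p a))
      rw [sub_sub_sub_cancel_right] at h1
      linarith [mul_nonneg hh.le hC2]
    refine ⟨hgu, ?_, (norm_fst_le _).trans e3, (norm_snd_le _).trans e3, e2.trans ?_⟩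
    · simpa [hgu, hgn] using huv.energy_eq hM hU' hg' hab.le
    · exact mul_le_mul_of_nonneg_right (by linarith) (by positivity)
  · rw [hba] at hl
    linarith [mul_nonneg hh.le hC2]
  · intro l' u' v' hl' huv hgu
    have hwa : (u' a, v' a) = (qn, pn) := by rw [huv.init_u, huv.init_v]
    have hln' : ‖l'‖ ≤ r + R := by
      have h1 := norm_le_norm_add_norm_sub' l' (multiplier M U g (q a) (p a))
      linarith
    exact hC.param_unique hB' hab hA (hc a haT) huv.isIntegralCurveOn hz (hwa.trans hza.symm)
      (by rw [hwa]; linarith) (by linarith) (by linarith) (by rw [hba]; linarith)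
      (by linarith) (by rw [hwa]; exact hxz) (by rw [hba]; linarith) hgu hgz
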